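/- Let $\Gamma\subset\mathrm{PSL}_2(\mathbb R)$ be a torsion-free lattice (that is, a discrete subgroup of finite covolume, with no element of finite order other than the identity) that has at least one cusp. Here a cusp of $\Gamma$ is a point of $\mathbb R\cup\{\infty\}$ fixed by a parabolic element of $\Gamma$. Let $V$ be a finite-dimensional complex inner product space and let $\chi:\Gamma\to\mathrm{GL}(V)$ be a representation that is unitary at the cusps: for every cusp $\mathfrak a$ of $\Gamma$ and every $\gamma\in\Gamma$ with $\gamma\mathfrak a=\mathfrak a$, the endomorphism $\chi(\gamma)$ is unitary. For $g=\pm\begin{pmatrix}a&b\\c&d\end{pmatrix}\in\mathrm{PSL}_2(\mathbb R)$ put $\mu(g)=a^2+b^2+c^2+d^2$, for $z,w$ in the upper half plane $\mathbb H$ put $u(z,w)=\dfrac{|z-w|^2}{\operatorname{Im}z\,\operatorname{Im}w}$, and let $\|\cdot\|$ be the operator norm on $\operatorname{End}(V)$. Then there exist $\sigma_0>1$, a constant $C_1>0$ and a continuous function $C_2:\mathbb H\times\mathbb H\to(0,\infty)$ such that $$\|\chi(\gamma)\|\le C_1\,\mu(\gamma)^{\sigma_0-1}\quad\text{for all }\gamma\in\Gamma$$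 and $$\|\chi(\gamma)\|\le C_2(z,w)\,\bigl(u(z,\gamma w)+1\bigr)^{\sigma_0-1}\quad\text{for all }z,w\in\mathbb H\text{ and all }\gamma\in\Gamma .$$ -/

import Mathlib

open MeasureTheory UpperHalfPlane
open scoped MatrixGroups

noncomputable section

namespace FuchsianTwist

/-- The action of `PSL(2, ℝ)` on the upper half plane by linear fractional transformations. -/
instance pslActionUpperHalfPlane : MulAction PSL(2, ℝ) ℍ :=
  MulAction.compHom ℍ (Matrix.ProjectiveSpecialLinearGroup.toPGL (n := Fin 2) (R := ℝ))

theorem psl_mk_smul (g : SL(2, ℝ)) (z : ℍ) : (g : PSL(2, ℝ)) • z = g • z := rfl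

theorem scalar_smul_onePoint (u : ℝˣ) (c : OnePoint ℝ) :
    Matrix.GeneralLinearGroup.scalar (Fin 2) u • c = c := by
  cases c with
  | infty => simp [OnePoint.smul_infty_eq_ite]
  | coe x => simp [OnePoint.smul_some_eq_ite]

/-- The action of `PSL(2, ℝ)` on the boundary `ℝ ∪ {∞}` of the upper half plane. -/
instance pslActionBoundary : MulAction PSL(2, ℝ) (OnePoint ℝ) :=
  letI : MulAction PGL(2, ℝ) (OnePoint ℝ) :=
    Matrix.ProjGenLinGroup.mulActionOfGL scalar_smul_onePoint
  MulAction.compHom (OnePoint ℝ) (Matrix.ProjectiveSpecialLinearGroup.toPGL (n := Fin 2) (R := ℝ))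

theorem psl_mk_smul_boundary (g : SL(2, ℝ)) (c : OnePoint ℝ) :
    (g : PSL(2, ℝ)) • c = Matrix.SpecialLinearGroup.toGL g • c := rfl

/-- The group of all real matrices of determinant one that represent an element of `Γ`. -/
def matrixPreimage (Γ : Subgroup PSL(2, ℝ)) : Subgroup (GL (Fin 2) ℝ) :=
  (Γ.comap (QuotientGroup.mk' (Subgroup.center SL(2, ℝ)))).map Matrix.SpecialLinearGroup.toGL

/-- `c` is a cusp of `Γ`: a boundary point fixed by some parabolic element of `Γ`. -/
def IsCuspOf (Γ : Subgroup PSL(2, ℝ)) (c : OnePoint ℝ) : Prop :=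
  IsCusp c (matrixPreimage Γ)

theorem isCuspOf_iff (Γ : Subgroup PSL(2, ℝ)) (c : OnePoint ℝ) :
    IsCuspOf Γ c ↔ ∃ g : SL(2, ℝ), (g : PSL(2, ℝ)) ∈ Γ ∧
      (g : Matrix (Fin 2) (Fin 2) ℝ).IsParabolic ∧ (g : PSL(2, ℝ)) • c = c := by
  constructor
  · rintro ⟨_, ⟨g, hg, rfl⟩, hp, hc⟩
    exact ⟨g, hg, hp, hc⟩
  · rintro ⟨g, hg, hp, hc⟩
    exact ⟨_, ⟨g, hg, rfl⟩, hp, hc⟩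

/-- `Γ` is a lattice in `PSL(2, ℝ)`: a discrete subgroup of finite covolume. The covolume is
measured on the upper half plane, with its invariant measure `dx dy / y²`. -/
structure IsLattice (Γ : Subgroup PSL(2, ℝ)) : Prop where
  discrete : DiscreteTopology Γ
  finite_covolume : ∃ F : Set ℍ, IsFundamentalDomain Γ F (volume : Measure ℍ) ∧
    (volume : Measure ℍ) F < ⊤

/-- No element other than the identity has finite order. -/
def IsTorsionFreeSubgroup (Γ : Subgroup PSL(2, ℝ)) : Prop :=
  ∀ γ ∈ Γ, γ ≠ 1 → ¬ IsOfFinOrder γ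

/-- The representation `χ` is unitary at the cusps: for every cusp `c`, each element of the
stabilizer of `c` in `Γ` acts by a unitary map. -/
def UnitaryAtCusps {Γ : Subgroup PSL(2, ℝ)} {V : Type*} [NormedAddCommGroup V]
    [InnerProductSpace ℂ V] [FiniteDimensional ℂ V] (χ : Representation ℂ Γ V) : Prop :=
  ∀ c : OnePoint ℝ, IsCuspOf Γ c → ∀ γ ∈ MulAction.stabilizer Γ c, χ γ ∈ unitary (V →ₗ[ℂ] V)

/-- The operator norm of an endomorphism of a finite-dimensional normed space. -/
def opNorm {V : Type*} [NormedAddCommGroup V] [InnerProductSpace ℂ V] [FiniteDimensional ℂ V]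
    (T : V →ₗ[ℂ] V) : ℝ :=
  ‖LinearMap.toContinuousLinearMap T‖

/-- The sum of the squares of the entries of a matrix, which depends only on its class
in `PSL(2, ℝ)`. -/
def mu : PSL(2, ℝ) → ℝ :=
  Quotient.lift (fun g : SL(2, ℝ) => g 0 0 ^ 2 + g 0 1 ^ 2 + g 1 0 ^ 2 + g 1 1 ^ 2) (by
    intro g h hgh
    have hmem : g⁻¹ * h ∈ Subgroup.center SL(2, ℝ) := QuotientGroup.leftRel_apply.mp hgh
    obtain ⟨r, hr, hs⟩ := Matrix.SpecialLinearGroup.mem_center_iff.mp hmem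
    simp only [Fintype.card_fin] at hr
    have hE : (h : Matrix (Fin 2) (Fin 2) ℝ) =
        (g : Matrix (Fin 2) (Fin 2) ℝ) * Matrix.scalar (Fin 2) r := by
      rw [hs, ← Matrix.SpecialLinearGroup.coe_mul, mul_inv_cancel_left]
    have hij : ∀ i j, (h : Matrix (Fin 2) (Fin 2) ℝ) i j = g i j * r := by
      intro i j
      rw [hE]
      simp
    simp only [hij, mul_pow, hr, mul_one])

theorem mu_mk (g : SL(2, ℝ)) :
    mu (g : PSL(2, ℝ)) = g 0 0 ^ 2 + g 0 1 ^ 2 + g 1 0 ^ 2 + g 1 1 ^ 2 := rfl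

/-- The point-pair invariant `u(z, w) = |z - w|² / (Im z · Im w)`. -/
def u (z w : ℍ) : ℝ :=
  ‖(z : ℂ) - (w : ℂ)‖ ^ 2 / (z.im * w.im)

end FuchsianTwist

end

noncomputable section

namespace FuchsianTwist

/-! Let `G` be the group of matrices in SL(2, ℝ) lying over Γ, and N(g) = ‖χ(g)‖. It suffices that
N(g) grow at most exponentially in d(i, g i): `mu` g is 2 cosh d(i, g i), and `u` + 2 is 2 cosh of
the distance.

Walk from i to g i in steps of length ε; a number of steps linear in the distance suffices
(`exists_reach_of_step`). Along the walk carry γ in `G` that records the position modulo `G`, and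
show that each step multiplies the bound for N(γ) by at most a constant. Finite covolume makes the
thick part compact modulo `G` (`hasCocompactThickPart_lift`), so between thick points γ changes by
one of finitely many elements. In the thin part, elements of small displacement at a common point
commute (`commute_of_defect_le`, a Margulis lemma) and are parabolic
(`exists_trSq_eq_four_of_defect_lt`), and γ is frozen during the excursion. On return, γ is
corrected by an element known, from finitely many data, up to a factor commuting with a parabolic
(`exists_transition_bound`). Such a factor fixes a cusp, so χ maps it to a unitary and it costs
nothing.

The algebra behind this: commuting with a non-central element of SL(2, ℝ) means having a
proportional traceless part. Hence commutation is transitive through non-central elements, and the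
displacement functions of commuting elements are proportional. -/

/-! ### Traceless parts, commutation and displacement in SL(2, ℝ) -/

/-- The square of the trace of a matrix in `SL(2, ℝ)`. -/
def trSq (g : SL(2, ℝ)) : ℝ := (g 0 0 + g 1 1) ^ 2

/-- The displacement of `z` under `g`, normalised to `2 cosh d(z, g z) - 2`. -/
def defect (g : SL(2, ℝ)) (z : ℍ) : ℝ := 2 * Real.cosh (dist z (g • z)) - 2

/-- The traceless part of `g` is `k` times the traceless part of `h`. -/
def Proportional (k : ℝ) (g h : SL(2, ℝ)) : Prop :=
  g 0 1 = k * h 0 1 ∧ g 1 0 = k * h 1 0 ∧ g 0 0 - g 1 1 = k * (h 0 0 - h 1 1)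

theorem det_eq_one (g : SL(2, ℝ)) : g 0 0 * g 1 1 - g 0 1 * g 1 0 = 1 := by
  rw [← Matrix.det_fin_two, g.det_coe]

theorem mul_entries (g h : SL(2, ℝ)) :
    (g * h) 0 0 = g 0 0 * h 0 0 + g 0 1 * h 1 0 ∧ (g * h) 0 1 = g 0 0 * h 0 1 + g 0 1 * h 1 1 ∧
    (g * h) 1 0 = g 1 0 * h 0 0 + g 1 1 * h 1 0 ∧ (g * h) 1 1 = g 1 0 * h 0 1 + g 1 1 * h 1 1 := by
  simp [Matrix.SpecialLinearGroup.coe_mul, Matrix.mul_apply, Fin.sum_univ_two]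

theorem inv_entries (g : SL(2, ℝ)) :
    g⁻¹ 0 0 = g 1 1 ∧ g⁻¹ 0 1 = - g 0 1 ∧ g⁻¹ 1 0 = - g 1 0 ∧ g⁻¹ 1 1 = g 0 0 := by
  simp [Matrix.SpecialLinearGroup.SL2_inv_expl]

theorem ext_entries {g h : SL(2, ℝ)} (h₁ : g 0 0 = h 0 0) (h₂ : g 0 1 = h 0 1)
    (h₃ : g 1 0 = h 1 0) (h₄ : g 1 1 = h 1 1) : g = h := by
  ext i j
  fin_cases i <;> fin_cases j <;> assumption

theorem mem_center_iff_entries (g : SL(2, ℝ)) :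
    g ∈ Subgroup.center SL(2, ℝ) ↔ g 0 1 = 0 ∧ g 1 0 = 0 ∧ g 0 0 = g 1 1 := by
  rw [Matrix.SpecialLinearGroup.mem_center_iff]
  constructor
  · rintro ⟨r, -, hr⟩
    have h : ∀ i j, g i j = Matrix.scalar (Fin 2) r i j := fun i j => by rw [hr]
    simp [h]
  · rintro ⟨h₁, h₂, h₃⟩
    have := det_eq_one g
    refine ⟨g 0 0, by rw [Fintype.card_fin]; rw [h₁, ← h₃] at this; linarith, ?_⟩
    ext i j
    fin_cases i <;> fin_cases j <;> simp [h₁, h₂, h₃]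

theorem eq_one_or_eq_neg_one {g : SL(2, ℝ)} (hg : g ∈ Subgroup.center SL(2, ℝ)) :
    g = 1 ∨ g = -1 := by
  obtain ⟨h₁, h₂, h₃⟩ := (mem_center_iff_entries g).1 hg
  have h := det_eq_one g
  rw [h₁, h₃, zero_mul, sub_zero, mul_self_eq_one_iff] at h
  rcases h with h | h
  · left; apply ext_entries <;> simp [*]
  · right; apply ext_entries <;> simp [*]

theorem conj_notMem_center {g : SL(2, ℝ)} (s : SL(2, ℝ)) (hg : g ∉ Subgroup.center SL(2, ℝ)) :
    s * g * s⁻¹ ∉ Subgroup.center SL(2, ℝ) := fun h => hg (by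
  have := Subgroup.Normal.conj_mem inferInstance _ h s⁻¹
  simpa [mul_assoc] using this)

theorem trSq_conj (s g : SL(2, ℝ)) : trSq (s * g * s⁻¹) = trSq g := by
  have h := det_eq_one s
  simp only [trSq, mul_entries, inv_entries]
  congr 1
  linear_combination (g 0 0 + g 1 1) * h

theorem Proportional.conj {k : ℝ} {g h : SL(2, ℝ)} (H : Proportional k g h) (s : SL(2, ℝ)) :
    Proportional k (s * g * s⁻¹) (s * h * s⁻¹) := by
  obtain ⟨h₁, h₂, h₃⟩ := H
  simp only [Proportional, mul_entries, inv_entries]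
  have hd := det_eq_one s
  refine ⟨?_, ?_, ?_⟩
  · linear_combination (s 0 0) ^ 2 * h₁ - (s 0 1) ^ 2 * h₂ - s 0 0 * s 0 1 * h₃
  · linear_combination -(s 1 0) ^ 2 * h₁ + (s 1 1) ^ 2 * h₂ + s 1 0 * s 1 1 * h₃
  · linear_combination -2 * s 0 0 * s 1 0 * h₁ + 2 * s 0 1 * s 1 1 * h₂ +
      (s 0 0 * s 1 1 + s 0 1 * s 1 0) * h₃

theorem Proportional.trans {k l : ℝ} {g h m : SL(2, ℝ)} (H : Proportional k g h)
    (H' : Proportional l h m) : Proportional (k * l) g m := by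
  obtain ⟨h₁, h₂, h₃⟩ := H
  obtain ⟨h₁', h₂', h₃'⟩ := H'
  refine ⟨?_, ?_, ?_⟩
  · rw [h₁, h₁', mul_assoc]
  · rw [h₂, h₂', mul_assoc]
  · rw [h₃, h₃', mul_assoc]

theorem Proportional.ne_zero {k : ℝ} {g h : SL(2, ℝ)} (H : Proportional k g h)
    (hg : g ∉ Subgroup.center SL(2, ℝ)) : k ≠ 0 := by
  rintro rfl
  obtain ⟨h₁, h₂, h₃⟩ := H
  simp only [zero_mul, sub_eq_zero] at h₁ h₂ h₃
  exact hg ((mem_center_iff_entries g).2 ⟨h₁, h₂, h₃⟩)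

theorem Proportional.symm {k : ℝ} {g h : SL(2, ℝ)} (H : Proportional k g h) (hk : k ≠ 0) :
    Proportional k⁻¹ h g := by
  obtain ⟨h₁, h₂, h₃⟩ := H
  refine ⟨?_, ?_, ?_⟩
  · rw [h₁, inv_mul_cancel_left₀ hk]
  · rw [h₂, inv_mul_cancel_left₀ hk]
  · rw [h₃, inv_mul_cancel_left₀ hk]

theorem Proportional.commute {k : ℝ} {g h : SL(2, ℝ)} (H : Proportional k g h) : Commute g h := by
  obtain ⟨h₁, h₂, h₃⟩ := H
  apply ext_entries <;> simp only [mul_entries]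
  · linear_combination h 1 0 * h₁ - h 0 1 * h₂
  · linear_combination (h 1 1 - h 0 0) * h₁ + h 0 1 * h₃
  · linear_combination (h 0 0 - h 1 1) * h₂ - h 1 0 * h₃
  · linear_combination - h 1 0 * h₁ + h 0 1 * h₂

theorem exists_proportional_of_commute {g h : SL(2, ℝ)} (H : Commute g h)
    (hh : h ∉ Subgroup.center SL(2, ℝ)) : ∃ k, Proportional k g h := by
  have e : ∀ i j, (g * h) i j = (h * g) i j := fun i j => by rw [H.eq]
  have e₁ := e 0 0
  have e₂ := e 0 1
  have e₃ := e 1 0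
  simp only [mul_entries] at e₁ e₂ e₃
  rw [mem_center_iff_entries] at hh
  by_cases hb : h 0 1 = 0
  · by_cases hc : h 1 0 = 0
    · have hd : h 0 0 - h 1 1 ≠ 0 := fun hd => hh ⟨hb, hc, sub_eq_zero.1 hd⟩
      refine ⟨(g 0 0 - g 1 1) / (h 0 0 - h 1 1), ?_, ?_, by field_simp⟩ <;> field_simp
      · linear_combination -e₂
      · linear_combination e₃
    · refine ⟨g 1 0 / h 1 0, ?_, by field_simp, ?_⟩ <;> field_simp
      · linear_combination e₁
      · linear_combination -e₃
  · refine ⟨g 0 1 / h 0 1, by field_simp, ?_, ?_⟩ <;> field_simp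
    · linear_combination -e₁
    · linear_combination e₂

theorem commute_trans {g h m : SL(2, ℝ)} (H : Commute g h) (H' : Commute h m)
    (hh : h ∉ Subgroup.center SL(2, ℝ)) : Commute g m := by
  by_cases hm : m ∈ Subgroup.center SL(2, ℝ)
  · exact Subgroup.mem_center_iff.1 hm g
  · obtain ⟨k, hk⟩ := exists_proportional_of_commute H hh
    obtain ⟨l, hl⟩ := exists_proportional_of_commute H' hm
    exact (hk.trans hl).commute

/-- With Q(z) = cz² + (d − a)z − b one has z − gz = Q(z)/(cz + d) and Im gz = Im z/|cz + d|², so |cz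
+ d| cancels. Since Q depends only on the traceless part of g, proportional elements have
proportional defects. -/
theorem defect_eq (g : SL(2, ℝ)) (z : ℍ) : defect g z =
    Complex.normSq (g 1 0 * (z : ℂ) ^ 2 + (g 1 1 - g 0 0) * z - g 0 1) / z.im ^ 2 := by
  have hden : (g 1 0 : ℂ) * z + g 1 1 ≠ 0 := denom_ne_zero g z
  have him : (g • z).im = z.im / Complex.normSq (g 1 0 * (z : ℂ) + g 1 1) := by
    rw [MulAction.compHom_smul_def, im_smul_eq_div_normSq]
    simp [denom]
  have hsub : (z : ℂ) - (g • z : ℍ) =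
      (g 1 0 * (z : ℂ) ^ 2 + (g 1 1 - g 0 0) * z - g 0 1) / (g 1 0 * (z : ℂ) + g 1 1) := by
    rw [coe_specialLinearGroup_apply]
    simp only [Algebra.algebraMap_self, RingHom.id_apply]
    rw [eq_div_iff hden, sub_mul, div_mul_cancel₀ _ hden]
    ring
  rw [defect, cosh_dist, him, Complex.dist_eq, ← Complex.normSq_eq_norm_sq, hsub,
    Complex.normSq_div]
  have := Complex.normSq_pos.2 hden
  have := z.im_pos
  field_simp
  ring

theorem defect_nonneg (g : SL(2, ℝ)) (z : ℍ) : 0 ≤ defect g z := by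
  rw [defect_eq]; exact div_nonneg (Complex.normSq_nonneg _) (sq_nonneg _)

theorem Proportional.defect {k : ℝ} {g h : SL(2, ℝ)} (H : Proportional k g h) (z : ℍ) :
    defect g z = k ^ 2 * FuchsianTwist.defect h z := by
  obtain ⟨h₁, h₂, h₃⟩ := H
  have : (g 1 0 * (z : ℂ) ^ 2 + (g 1 1 - g 0 0) * z - g 0 1) =
      (k : ℂ) * (h 1 0 * (z : ℂ) ^ 2 + (h 1 1 - h 0 0) * z - h 0 1) := by
    have h₃' : (g 0 0 : ℂ) - g 1 1 = k * (h 0 0 - h 1 1) := by exact_mod_cast h₃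
    rw [h₁, h₂]
    push_cast
    linear_combination -z * h₃'
  rw [defect_eq, defect_eq, this, Complex.normSq_mul, Complex.normSq_ofReal]
  ring

theorem trSq_eq (g : SL(2, ℝ)) : trSq g - 4 = (g 0 0 - g 1 1) ^ 2 + 4 * (g 0 1 * g 1 0) := by
  rw [trSq]; linear_combination 4 * det_eq_one g

theorem Proportional.trSq {k : ℝ} {g h : SL(2, ℝ)} (H : Proportional k g h) :
    trSq g - 4 = k ^ 2 * (FuchsianTwist.trSq h - 4) := by
  obtain ⟨h₁, h₂, h₃⟩ := H
  rw [trSq_eq, trSq_eq, h₁, h₂, h₃]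
  ring

/-- The gap is (c|z|² + (d − a)x − b)²/y². -/
theorem trSq_sub_le_defect (g : SL(2, ℝ)) (z : ℍ) : trSq g - 4 ≤ defect g z := by
  have hy := z.im_pos
  have hz : (z : ℂ) = z.re + z.im * Complex.I := (Complex.re_add_im _).symm
  rw [defect_eq, trSq_eq, le_div_iff₀ (by positivity), hz]
  simp only [Complex.normSq_apply, pow_two]
  simp
  nlinarith [sq_nonneg (g 1 0 * (z.re ^ 2 + z.im ^ 2) + (g 1 1 - g 0 0) * z.re - g 0 1)]

/-- A fixed point in ℍ would be a non-real root of the real quadratic Q, whose discriminant tr² − 4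
is nonnegative; then Q vanishes identically and g is central. -/
theorem defect_pos {g : SL(2, ℝ)} (hg : g ∉ Subgroup.center SL(2, ℝ)) (h4 : 4 ≤ trSq g) (z : ℍ) :
    0 < defect g z := by
  have hy := z.im_pos
  have hz : (z : ℂ) = z.re + z.im * Complex.I := (Complex.re_add_im _).symm
  refine (defect_nonneg g z).lt_of_ne fun h0 => hg ?_
  rw [defect_eq, eq_comm, div_eq_zero_iff, or_iff_left (by positivity), Complex.normSq_eq_zero,
    hz, Complex.ext_iff] at h0
  have h5 := trSq_eq g
  simp [pow_two] at h0
  obtain ⟨h1, h2⟩ := h0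
  have h3 : g 1 0 * (2 * z.re) + (g 1 1 - g 0 0) = 0 := by
    apply mul_right_cancel₀ hy.ne'
    linear_combination h2
  have h6 : g 0 1 = - g 1 0 * (z.re ^ 2 + z.im ^ 2) := by linear_combination -h1 + z.re * h3
  have h7 : g 0 0 - g 1 1 = 2 * z.re * g 1 0 := by linear_combination -h3
  have h8 : g 1 0 = 0 := by
    rw [h6, h7] at h5
    by_contra hne
    have := mul_pos (sq_pos_of_ne_zero hne) (sq_pos_of_pos hy)
    nlinarith
  rw [mem_center_iff_entries]
  refine ⟨by rw [h6, h8]; simp, h8, by rw [h8] at h7; linarith⟩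

theorem defect_conj (s g : SL(2, ℝ)) (z : ℍ) : defect (s * g * s⁻¹) (s • z) = defect g z := by
  rw [defect, defect, mul_smul, inv_smul_smul, mul_smul, dist_smul]

theorem mu_eq_two_cosh (g : SL(2, ℝ)) :
    g 0 0 ^ 2 + g 0 1 ^ 2 + g 1 0 ^ 2 + g 1 1 ^ 2 = 2 * Real.cosh (dist I (g • I)) := by
  have h : defect g I = _ := defect_eq g I
  rw [defect] at h
  have hd := det_eq_one g
  simp [Complex.normSq_apply] at h
  nlinarith

theorem continuous_defect (g : SL(2, ℝ)) : Continuous (defect g) := by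
  unfold defect
  fun_prop

/-! ### Discrete groups without elliptic elements -/

/-- A subgroup of `SL(2, ℝ)` with finitely many elements of bounded displacement, containing `-1`, all of whose
non-central elements are parabolic or hyperbolic. -/
structure IsDiscreteNonelliptic (G : Subgroup SL(2, ℝ)) : Prop where
  finite_dist_I_le : ∀ M : ℝ, {g : SL(2, ℝ) | g ∈ G ∧ dist I (g • I) ≤ M}.Finite
  neg_one_mem : -1 ∈ G
  four_le_trSq : ∀ g ∈ G, g ∉ Subgroup.center SL(2, ℝ) → 4 ≤ trSq g

theorem dist_le_defect_add_two (g : SL(2, ℝ)) (z : ℍ) : dist z (g • z) ≤ defect g z + 2 := by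
  have h₁ := Real.add_one_le_exp (dist z (g • z))
  have h₂ := Real.exp_pos (-dist z (g • z))
  rw [defect, Real.cosh_eq]
  linarith

namespace IsDiscreteNonelliptic

variable {G : Subgroup SL(2, ℝ)}

theorem finite_exists_dist_le (hG : IsDiscreteNonelliptic G) (R r : ℝ) :
    {g : SL(2, ℝ) | g ∈ G ∧ ∃ x : ℍ, dist I x ≤ R ∧ dist x (g • x) ≤ r}.Finite := by
  refine (hG.finite_dist_I_le (R + r + R)).subset ?_
  rintro g ⟨hg, x, hx, hr⟩
  refine ⟨hg, ?_⟩
  calc dist I (g • I) ≤ dist I x + dist x (g • x) + dist (g • x) (g • I) := dist_triangle4 ..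
    _ ≤ R + r + R := by rw [dist_smul, dist_comm x I]; gcongr

theorem finite_dist_le (hG : IsDiscreteNonelliptic G) (z : ℍ) (r : ℝ) :
    {g : SL(2, ℝ) | g ∈ G ∧ dist z (g • z) ≤ r}.Finite :=
  (hG.finite_exists_dist_le (dist I z) r).subset fun _ hg => ⟨hg.1, z, le_rfl, hg.2⟩

theorem finite_defect_le (hG : IsDiscreteNonelliptic G) (z : ℍ) (r : ℝ) :
    {g : SL(2, ℝ) | g ∈ G ∧ defect g z ≤ r}.Finite := by
  refine (hG.finite_dist_le z (r + 2)).subset ?_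
  rintro g ⟨hg, hr⟩
  exact ⟨hg, (dist_le_defect_add_two g z).trans (by gcongr)⟩

theorem conj_pow_proportional {β : ℝ} {A B : SL(2, ℝ)} (h : Proportional β (A * B * A⁻¹) B)
    (n : ℕ) : Proportional (β ^ n) (A ^ n * B * (A ^ n)⁻¹) B := by
  induction n with
  | zero => simp [Proportional]
  | succ n ih =>
    have := (ih.conj A).trans h
    rw [pow_succ β, pow_succ' A]
    convert! this using 1
    group

/-- If β² < 1, the conjugates AⁿBA⁻ⁿ have defects β²ⁿ · `defect B I` at i: infinitely many elements
of bounded displacement. -/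
theorem one_le_sq_of_conj_proportional (hG : IsDiscreteNonelliptic G) {β : ℝ} {A B : SL(2, ℝ)}
    (hA : A ∈ G) (hB : B ∈ G) (hBc : B ∉ Subgroup.center SL(2, ℝ))
    (h : Proportional β (A * B * A⁻¹) B) : 1 ≤ β ^ 2 := by
  by_contra! hlt
  have hβ : 0 < β ^ 2 := sq_pos_of_ne_zero (h.ne_zero (conj_notMem_center A hBc))
  have hd := defect_pos hBc (hG.four_le_trSq B hB hBc) I
  have hdef : ∀ n, defect (A ^ n * B * (A ^ n)⁻¹) I = (β ^ 2) ^ n * defect B I := fun n => by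
    rw [(conj_pow_proportional h n).defect, ← pow_mul, ← pow_mul, mul_comm n 2]
  refine Set.infinite_of_injective_forall_mem (f := fun n : ℕ => A ^ n * B * (A ^ n)⁻¹) ?_ ?_
    (hG.finite_defect_le I (defect B I))
  · intro m n hmn
    have := congrArg (fun g => defect g I) hmn
    simp only [hdef] at this
    exact pow_right_injective₀ hβ hlt.ne (mul_right_cancel₀ hd.ne' this)
  · intro n
    refine ⟨G.mul_mem (G.mul_mem (G.pow_mem hA n) hB) (G.inv_mem (G.pow_mem hA n)), ?_⟩
    rw [hdef]
    exact mul_le_of_le_one_left hd.le (pow_le_one₀ hβ.le hlt.le)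

/-- If `A` conjugates a non-central `B` into the centraliser of `B`, then it commutes with `B`. -/
theorem commute_of_commute_conj (hG : IsDiscreteNonelliptic G) {A B : SL(2, ℝ)} (hA : A ∈ G)
    (hB : B ∈ G) (hBc : B ∉ Subgroup.center SL(2, ℝ)) (h : Commute (A * B * A⁻¹) B) :
    Commute A B := by
  obtain ⟨β, hβ⟩ := exists_proportional_of_commute h hBc
  have hβ0 := hβ.ne_zero (conj_notMem_center A hBc)
  have h1 := hG.one_le_sq_of_conj_proportional hA hB hBc hβ
  have h2 : 1 ≤ β⁻¹ ^ 2 := by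
    refine hG.one_le_sq_of_conj_proportional (G.inv_mem hA) hB hBc ?_
    have := (hβ.symm hβ0).conj A⁻¹
    convert! this using 1
    group
  have hsq : β ^ 2 = 1 := by
    refine le_antisymm ?_ h1
    rw [inv_pow] at h2
    exact (one_le_inv₀ (by positivity)).1 h2
  have hdA := det_eq_one A
  have htr : (A * B * A⁻¹) 0 0 + (A * B * A⁻¹) 1 1 = B 0 0 + B 1 1 := by
    simp only [mul_entries, inv_entries]
    linear_combination (B 0 0 + B 1 1) * hdA
  -- Conjugation preserves the trace, so β = 1 gives ABA⁻¹ = B and β = −1 gives ABA⁻¹ = B⁻¹. In the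
  -- second case tr A times the traceless part of B vanishes, while tr A ≠ 0 because A is not
  -- elliptic.
  rcases (mul_self_eq_one_iff.1 (by rw [← sq, hsq]) : β = 1 ∨ β = -1) with rfl | rfl
  · obtain ⟨h₁, h₂, h₃⟩ := hβ
    have : A * B * A⁻¹ = B := by
      apply ext_entries <;> linarith
    exact mul_inv_eq_iff_eq_mul.1 this
  · by_cases hAc : A ∈ Subgroup.center SL(2, ℝ)
    · exact (Subgroup.mem_center_iff.1 hAc B).symm
    have h4 := hG.four_le_trSq A hA hAc
    have ht : A 0 0 + A 1 1 ≠ 0 := by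
      intro h0
      rw [trSq, h0] at h4
      norm_num at h4
    obtain ⟨h₁, h₂, h₃⟩ := hβ
    have hinv : A * B * A⁻¹ = B⁻¹ := by
      apply ext_entries <;> simp only [inv_entries B] <;> linarith
    rw [mul_inv_eq_iff_eq_mul] at hinv
    have e : ∀ i j, (A * B) i j = (B⁻¹ * A) i j := fun i j => by rw [hinv]
    have e₁ := e 0 0
    have e₂ := e 0 1
    have e₃ := e 1 0
    have e₄ := e 1 1
    simp only [mul_entries, inv_entries] at e₁ e₂ e₃ e₄
    refine absurd ((mem_center_iff_entries B).2 ⟨?_, ?_, ?_⟩) hBc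
    · apply mul_right_cancel₀ ht; linarith
    · apply mul_right_cancel₀ ht; linarith
    · apply mul_right_cancel₀ ht; linarith

end IsDiscreteNonelliptic

/-! ### Commutators of elements near the identity -/

theorem norm_commutator_sub_one_le {R : Type*} [NormedRing R] {a b a' b' : R} (ha : a * a' = 1)
    (hb : b * b' = 1) :
    ‖a * b * a' * b' - 1‖ ≤ 2 * ‖a - 1‖ * ‖b - 1‖ * ‖a'‖ * ‖b'‖ := by
  have h : a * b * a' * b' - 1 = ((a - 1) * (b - 1) - (b - 1) * (a - 1)) * a' * b' := by
    have h1 : b * a * a' * b' = 1 := by rw [mul_assoc b, ha, mul_one, hb]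
    calc a * b * a' * b' - 1 = a * b * a' * b' - b * a * a' * b' := by rw [h1]
      _ = _ := by noncomm_ring
  rw [h]
  calc _ ≤ ‖(a - 1) * (b - 1) - (b - 1) * (a - 1)‖ * ‖a'‖ * ‖b'‖ := by
        refine (norm_mul_le _ _).trans ?_
        gcongr
        exact norm_mul_le _ _
    _ ≤ (‖a - 1‖ * ‖b - 1‖ + ‖b - 1‖ * ‖a - 1‖) * ‖a'‖ * ‖b'‖ := by
        gcongr
        exact (norm_sub_le _ _).trans (add_le_add (norm_mul_le _ _) (norm_mul_le _ _))
    _ = _ := by ring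

section Frobenius

attribute [local instance] Matrix.frobeniusNormedRing

theorem frobenius_norm_sq (m : Matrix (Fin 2) (Fin 2) ℝ) :
    ‖m‖ ^ 2 = m 0 0 ^ 2 + m 0 1 ^ 2 + m 1 0 ^ 2 + m 1 1 ^ 2 := by
  rw [Matrix.frobenius_norm_def, ← Real.sqrt_eq_rpow, Real.sq_sqrt (by positivity)]
  simp [Fin.sum_univ_two]
  ring

/-- The Frobenius distance from a matrix to the identity. -/
def distOne (g : SL(2, ℝ)) : ℝ := ‖(g : Matrix (Fin 2) (Fin 2) ℝ) - 1‖

theorem distOne_nonneg (g : SL(2, ℝ)) : 0 ≤ distOne g := norm_nonneg _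

theorem distOne_sq (g : SL(2, ℝ)) :
    distOne g ^ 2 = (g 0 0 - 1) ^ 2 + g 0 1 ^ 2 + g 1 0 ^ 2 + (g 1 1 - 1) ^ 2 := by
  rw [distOne, frobenius_norm_sq]
  simp

theorem eq_one_of_distOne_eq_zero {g : SL(2, ℝ)} (h : distOne g = 0) : g = 1 :=
  Subtype.ext (sub_eq_zero.1 (norm_eq_zero.1 h))

theorem distOne_inv (g : SL(2, ℝ)) : distOne g⁻¹ = distOne g := by
  rw [← sq_eq_sq₀ (distOne_nonneg _) (distOne_nonneg _), distOne_sq, distOne_sq]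
  simp only [inv_entries]
  ring

theorem norm_le_two {g : SL(2, ℝ)} (h : distOne g ≤ 1 / 16) :
    ‖(g : Matrix (Fin 2) (Fin 2) ℝ)‖ ≤ 2 := by
  have h1 : ‖(1 : Matrix (Fin 2) (Fin 2) ℝ)‖ ≤ 3 / 2 := by
    rw [← sq_le_sq₀ (norm_nonneg _) (by norm_num), frobenius_norm_sq]
    norm_num
  have h2 := norm_add_le ((g : Matrix (Fin 2) (Fin 2) ℝ) - 1) 1
  rw [sub_add_cancel] at h2
  rw [distOne] at h
  linarith

/-- The threshold 1/16 is chosen so that 2 · (1/16) · 2 · 2 = 1/2, the inverses having norm at most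
2. -/
theorem distOne_commutator_le {a b : SL(2, ℝ)} (ha : distOne a ≤ 1 / 16)
    (hb : distOne b ≤ 1 / 16) : distOne (a * b * a⁻¹ * b⁻¹) ≤ distOne a / 2 := by
  have key := norm_commutator_sub_one_le (a := (a : Matrix (Fin 2) (Fin 2) ℝ))
    (b := (b : Matrix (Fin 2) (Fin 2) ℝ)) (a' := (a⁻¹ : SL(2, ℝ))) (b' := (b⁻¹ : SL(2, ℝ)))
    (by rw [← Matrix.SpecialLinearGroup.coe_mul]; simp)
    (by rw [← Matrix.SpecialLinearGroup.coe_mul]; simp)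
  have ha' := norm_le_two ((distOne_inv a).trans_le ha)
  have hb' := norm_le_two ((distOne_inv b).trans_le hb)
  have e : distOne (a * b * a⁻¹ * b⁻¹) ≤ 2 * distOne a * distOne b *
      ‖((a⁻¹ : SL(2, ℝ)) : Matrix (Fin 2) (Fin 2) ℝ)‖ *
      ‖((b⁻¹ : SL(2, ℝ)) : Matrix (Fin 2) (Fin 2) ℝ)‖ := by
    simpa only [distOne, Matrix.SpecialLinearGroup.coe_mul] using key
  have := distOne_nonneg a
  have := distOne_nonneg b
  calc _ ≤ _ := e
    _ ≤ 2 * distOne a * (1 / 16) * 2 * 2 := by gcongr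
    _ = distOne a / 2 := by ring

theorem defect_I_le_two {g : SL(2, ℝ)} (h : distOne g ≤ 1 / 16) : defect g I ≤ 2 := by
  have h1 := norm_le_two h
  have h2 := frobenius_norm_sq (g : Matrix (Fin 2) (Fin 2) ℝ)
  rw [mu_eq_two_cosh] at h2
  rw [defect, ← h2]
  nlinarith [norm_nonneg (g : Matrix (Fin 2) (Fin 2) ℝ)]

end Frobenius

/-- The left side is μ − 2 tr + 2 and the right side μ − 2. -/
theorem distOne_sq_le_defect {g : SL(2, ℝ)} (h : 2 ≤ g 0 0 + g 1 1) :
    distOne g ^ 2 ≤ defect g I := by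
  rw [distOne_sq, defect, ← mu_eq_two_cosh]
  linarith

/-! ### Margulis lemma -/

namespace IsDiscreteNonelliptic

variable {G : Subgroup SL(2, ℝ)}

/-- Zassenhaus argument: the iterated commutators Sₙ₊₁ = [Sₙ, B] at least halve their distance to 1
(after conjugation by s⁻¹), so discreteness makes some Sₙ trivial. Then descend: if [Sₙ, B] commutes
with B, so does SₙBSₙ⁻¹, hence so does Sₙ. -/
theorem commute_of_distOne_conj_le (hG : IsDiscreteNonelliptic G) (s : SL(2, ℝ)) {A B : SL(2, ℝ)}
    (hA : A ∈ G) (hB : B ∈ G) (hdA : distOne (s⁻¹ * A * s) ≤ 1 / 16)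
    (hdB : distOne (s⁻¹ * B * s) ≤ 1 / 16) : Commute A B := by
  by_cases hBc : B ∈ Subgroup.center SL(2, ℝ)
  · exact Subgroup.mem_center_iff.1 hBc A
  let F : SL(2, ℝ) → SL(2, ℝ) := fun X => X * B * X⁻¹ * B⁻¹
  let S : ℕ → SL(2, ℝ) := fun n => F^[n] A
  have hS : ∀ n, S (n + 1) = S n * B * (S n)⁻¹ * B⁻¹ := fun n => by
    simp only [S, Function.iterate_succ_apply', F]
  have hmem : ∀ n, S n ∈ G := by
    intro n
    induction n with
    | zero => exact hA
    | succ n ih =>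
      rw [hS]
      exact G.mul_mem (G.mul_mem (G.mul_mem ih hB) (G.inv_mem ih)) (G.inv_mem hB)
  have hconj : ∀ n, s⁻¹ * S (n + 1) * s = (s⁻¹ * S n * s) * (s⁻¹ * B * s) *
      (s⁻¹ * S n * s)⁻¹ * (s⁻¹ * B * s)⁻¹ := fun n => by rw [hS]; group
  have hle : ∀ n, distOne (s⁻¹ * S n * s) ≤ 1 / 16 := by
    intro n
    induction n with
    | zero => exact hdA
    | succ n ih =>
      rw [hconj]
      have := distOne_commutator_le ih hdB
      have := distOne_nonneg (s⁻¹ * S n * s)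
      linarith
  have hex : ∃ n, S n = 1 := by
    by_contra! hne
    have hpos : ∀ n, 0 < distOne (s⁻¹ * S n * s) := fun n => by
      refine (distOne_nonneg _).lt_of_ne fun h0 => hne n ?_
      have := eq_one_of_distOne_eq_zero h0.symm
      rw [mul_eq_one_iff_eq_inv, mul_eq_left] at this
      exact this
    have hanti : StrictAnti fun n => distOne (s⁻¹ * S n * s) := by
      refine strictAnti_nat_of_succ_lt fun n => ?_
      rw [hconj]
      have := distOne_commutator_le (hle n) hdB
      have := hpos n
      linarith
    refine Set.infinite_of_injective_forall_mem (f := S) ?_ ?_ (hG.finite_defect_le (s • I) 2)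
    · intro m n hmn
      exact hanti.injective (by simp only [hmn])
    · intro n
      refine ⟨hmem n, ?_⟩
      have := defect_conj s (s⁻¹ * S n * s) I
      rw [show s * (s⁻¹ * S n * s) * s⁻¹ = S n by group] at this
      rw [this]
      exact defect_I_le_two (hle n)
  obtain ⟨n, hn⟩ := hex
  have hdesc : ∀ n, Commute (S n) B → Commute A B := by
    intro n
    induction n with
    | zero => exact id
    | succ n ih =>
      intro h
      refine ih (hG.commute_of_commute_conj (hmem n) hB hBc ?_)
      rw [hS] at h
      simpa using h.mul_left (Commute.refl B)
  exact hdesc n (by rw [hn]; exact Commute.one_left B)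

/-- The displacement ignores the sign, so choose the representative with trace at least 2; the bound
1/256 is (1/16)². -/
theorem exists_distOne_conj_le (hG : IsDiscreteNonelliptic G) {A : SL(2, ℝ)} (hA : A ∈ G)
    (hAc : A ∉ Subgroup.center SL(2, ℝ)) (s : SL(2, ℝ)) (hd : defect A (s • I) ≤ 1 / 256) :
    ∃ A' ∈ G, (A' = A ∨ A' = -A) ∧ distOne (s⁻¹ * A' * s) ≤ 1 / 16 := by
  have main : ∀ A' : SL(2, ℝ), defect A' (s • I) ≤ 1 / 256 → 2 ≤ A' 0 0 + A' 1 1 →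
      distOne (s⁻¹ * A' * s) ≤ 1 / 16 := by
    intro A' h h2
    have ht : (s⁻¹ * A' * s) 0 0 + (s⁻¹ * A' * s) 1 1 = A' 0 0 + A' 1 1 := by
      simp only [mul_entries, inv_entries]
      linear_combination (A' 0 0 + A' 1 1) * det_eq_one s
    have h3 := distOne_sq_le_defect (h2.trans_eq ht.symm)
    have h4 := defect_conj s (s⁻¹ * A' * s) I
    rw [show s * (s⁻¹ * A' * s) * s⁻¹ = A' by group] at h4
    rw [← h4] at h3
    rw [← sq_le_sq₀ (distOne_nonneg _) (by norm_num)]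
    linarith
  have h4 := hG.four_le_trSq A hA hAc
  rw [trSq] at h4
  rcases le_total 0 (A 0 0 + A 1 1) with h0 | h0
  · exact ⟨A, hA, Or.inl rfl, main A hd (by nlinarith)⟩
  · have hneg : -A = -1 * A := by rw [neg_mul, one_mul]
    refine ⟨-A, by rw [hneg]; exact G.mul_mem hG.neg_one_mem hA, Or.inr rfl, main _ ?_ ?_⟩
    · have hp : Proportional (-1) (-A) A := by
        simp only [Proportional, Matrix.SpecialLinearGroup.coe_neg, Matrix.neg_apply]
        refine ⟨?_, ?_, ?_⟩ <;> ring
      rwa [hp.defect, neg_one_sq, one_mul]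
    · simp only [Matrix.SpecialLinearGroup.coe_neg, Matrix.neg_apply]
      nlinarith

/-- Two elements that both move the same point by little commute. -/
theorem commute_of_defect_le (hG : IsDiscreteNonelliptic G) {A B : SL(2, ℝ)} (hA : A ∈ G)
    (hB : B ∈ G) {z : ℍ} (hdA : defect A z ≤ 1 / 256) (hdB : defect B z ≤ 1 / 256) :
    Commute A B := by
  by_cases hAc : A ∈ Subgroup.center SL(2, ℝ)
  · exact (Subgroup.mem_center_iff.1 hAc B).symm
  by_cases hBc : B ∈ Subgroup.center SL(2, ℝ)
  · exact Subgroup.mem_center_iff.1 hBc A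
  rw [← toSL2R_smul_I z] at hdA hdB
  obtain ⟨A', hA', hAA, h1⟩ := hG.exists_distOne_conj_le hA hAc _ hdA
  obtain ⟨B', hB', hBB, h2⟩ := hG.exists_distOne_conj_le hB hBc _ hdB
  have := hG.commute_of_distOne_conj_le _ hA' hB' h1 h2
  rcases hAA with rfl | rfl <;> rcases hBB with rfl | rfl <;> simpa using this

end IsDiscreteNonelliptic

/-! ### The thick part, and why short elements are parabolic -/

/-- Every point moved by at least `ε` by all noncentral elements of `G` lies, up to `G`, in a ball
whose radius depends only on `ε`. -/
def HasCocompactThickPart (G : Subgroup SL(2, ℝ)) : Prop :=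
  ∀ ε : ℝ, 0 < ε → ∃ R : ℝ, ∀ z : ℍ,
    (∀ g ∈ G, g ∉ Subgroup.center SL(2, ℝ) → ε ≤ dist z (g • z)) → ∃ g ∈ G, dist I (g • z) ≤ R

/-- Approach a real x with Q(x) ≠ 0 vertically: |Q(x + iy)|²/y² blows up as y → 0. -/
theorem exists_defect_gt {g : SL(2, ℝ)} (hg : g ∉ Subgroup.center SL(2, ℝ)) (M : ℝ) :
    ∃ z : ℍ, M < defect g z := by
  obtain ⟨x, hx⟩ : ∃ x : ℝ, g 1 0 * x ^ 2 + (g 1 1 - g 0 0) * x - g 0 1 ≠ 0 := by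
    by_contra! h
    have h0 := h 0
    have h1 := h 1
    have h2 := h (-1)
    refine hg ((mem_center_iff_entries g).2 ⟨by linarith, by linarith, by linarith⟩)
  set P := g 1 0 * x ^ 2 + (g 1 1 - g 0 0) * x - g 0 1 with hP
  have hPpos : 0 < |P| := abs_pos.2 hx
  set D := |g 1 0| + |P| + |M| + 1 with hD
  have hD1 : 1 ≤ D := by rw [hD]; linarith [abs_nonneg (g 1 0), abs_nonneg P, abs_nonneg M]
  set y := |P| / (2 * D) with hy
  have hy0 : 0 < y := by positivity
  have hyD : 2 * (y * D) = |P| := by rw [hy]; field_simp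
  refine ⟨⟨⟨x, y⟩, hy0⟩, ?_⟩
  rw [defect_eq, lt_div_iff₀ (sq_pos_of_pos (UpperHalfPlane.im_pos _)), Complex.normSq_apply]
  simp [pow_two]
  have hre : g 1 0 * (x * x - y * y) + (g 1 1 - g 0 0) * x - g 0 1 = P - g 1 0 * (y * y) := by
    rw [hP]; ring
  rw [hre]
  have hy1 : y ≤ 1 := by
    rw [hy, div_le_one (by positivity)]
    linarith [abs_nonneg (g 1 0), abs_nonneg P, abs_nonneg M]
  have h1 : |g 1 0 * (y * y)| ≤ y * |g 1 0| := by
    rw [abs_mul, abs_of_pos (mul_pos hy0 hy0), mul_comm]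
    gcongr
    nlinarith
  have h2 : y * (|P| + |M| + 1) ≤ |P - g 1 0 * (y * y)| := by
    have h3 := abs_sub_abs_le_abs_sub P (g 1 0 * (y * y))
    nlinarith [mul_pos hy0 (by linarith : 0 < D)]
  have h4 : |M| + 1 ≤ |P| + |M| + 1 := by linarith
  have h5 : (y * (|M| + 1)) ^ 2 ≤ (P - g 1 0 * (y * y)) ^ 2 := by
    rw [← sq_abs (P - _)]
    gcongr
    exact (mul_le_mul_of_nonneg_left h4 hy0.le).trans h2
  have h6 : M < (|M| + 1) ^ 2 := by nlinarith [le_abs_self M, abs_nonneg M]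
  have h7 := mul_lt_mul_of_pos_right h6 (mul_pos hy0 hy0)
  nlinarith [mul_self_nonneg (g 1 0 * (x * y + y * x) + (g 1 1 - g 0 0) * y)]

theorem exists_defect_lt_of_dist_le {c : ℝ} (hc : 0 < c) :
    ∃ ε > 0, ∀ (g : SL(2, ℝ)) (z : ℍ), dist z (g • z) ≤ ε → defect g z < c := by
  have hcont : Continuous fun d : ℝ => 2 * Real.cosh d - 2 := by fun_prop
  have h := hcont.tendsto 0
  simp only [Real.cosh_zero, mul_one, sub_self] at h
  obtain ⟨ε, hε, hb⟩ := Metric.eventually_nhds_iff.1 (h.eventually (gt_mem_nhds hc))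
  refine ⟨ε / 2, by positivity, fun g z hd => hb ?_⟩
  rw [Real.dist_eq, sub_zero, abs_of_nonneg dist_nonneg]
  linarith

theorem exists_pos_le_of_finite {α : Type*} {S : Set α} (hS : S.Finite) (f : α → ℝ)
    (hf : ∀ x ∈ S, 0 < f x) : ∃ τ > 0, ∀ x ∈ S, τ ≤ f x := by
  rcases S.eq_empty_or_nonempty with rfl | hne
  · exact ⟨1, one_pos, by simp⟩
  · obtain ⟨x, hx, hmin⟩ := Set.exists_min_image S f hS hne
    exact ⟨f x, hf x hx, hmin⟩

namespace IsDiscreteNonelliptic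

variable {G : Subgroup SL(2, ℝ)}

/-- Among the non-central elements of `G` commuting with `g`, some `η` moves every point the
least. -/
theorem exists_defect_minimal (hG : IsDiscreteNonelliptic G) {g : SL(2, ℝ)} (hg : g ∈ G)
    (hgc : g ∉ Subgroup.center SL(2, ℝ)) :
    ∃ η ∈ G, η ∉ Subgroup.center SL(2, ℝ) ∧ Commute η g ∧
      ∀ h ∈ G, h ∉ Subgroup.center SL(2, ℝ) → Commute h g → ∀ z, defect η z ≤ defect h z := by
  obtain ⟨η, ⟨⟨hη, hηg⟩, hηc, hcomm⟩, hmin⟩ := Set.exists_min_image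
    ({h : SL(2, ℝ) | h ∈ G ∧ defect h I ≤ defect g I} ∩
      {h | h ∉ Subgroup.center SL(2, ℝ) ∧ Commute h g}) (fun h => defect h I)
    ((hG.finite_defect_le I _).subset Set.inter_subset_left)
    ⟨g, ⟨hg, le_rfl⟩, hgc, Commute.refl g⟩
  refine ⟨η, hη, hηc, hcomm, fun h hh hhc hhg z => ?_⟩
  have hI : defect η I ≤ defect h I := by
    rcases le_total (defect h I) (defect g I) with hle | hle
    · exact hmin h ⟨⟨hh, hle⟩, hhc, hhg⟩
    · exact hηg.trans hle
  -- The two defects differ by the constant factor k², so minimality at i gives minimality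
  -- everywhere.
  obtain ⟨k, hk⟩ := exists_proportional_of_commute (commute_trans hhg hcomm.symm hgc) hηc
  rw [hk.defect] at hI ⊢
  have hpos := defect_pos hηc (hG.four_le_trSq η hη hηc) I
  exact le_mul_of_one_le_left (defect_nonneg η z) ((le_mul_iff_one_le_left hpos).1 hI)

/-- Elements of `G` that move some point by little are central or parabolic. -/
theorem exists_trSq_eq_four_of_defect_lt (hG : IsDiscreteNonelliptic G)
    (hthick : HasCocompactThickPart G) :
    ∃ τ > 0, ∀ g ∈ G, g ∉ Subgroup.center SL(2, ℝ) → ∀ z, defect g z < τ → trSq g = 4 := by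
  obtain ⟨ε, hε, hdist⟩ := exists_defect_lt_of_dist_le (c := 1 / 256) (by norm_num)
  obtain ⟨R, hR⟩ := hthick ε hε
  obtain ⟨τ, hτ, hmin⟩ := exists_pos_le_of_finite
    ((hG.finite_exists_dist_le R (1 / 256 + 2)).inter_of_left {e | 4 < trSq e})
    (fun e => trSq e - 4) fun e he => sub_pos.2 he.2
  refine ⟨min τ (1 / 256), by positivity, fun g hg hgc z hz => ?_⟩
  obtain ⟨hzτ, hz⟩ := lt_min_iff.1 hz
  obtain ⟨η, hη, hηc, hcomm, hηmin⟩ := hG.exists_defect_minimal hg hgc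
  have hηz := hηmin g hg hgc (Commute.refl g) z
  -- Slide to a point where η sits exactly at the Margulis threshold. It is thick: a shorter element
  -- there would commute with η and contradict its minimality. So some conjugate of η lies in a
  -- finite set, and if hyperbolic has tr² − 4 ≥ τ, against tr² − 4 ≤ `defect η z` < τ.
  obtain ⟨z', hz'⟩ : ∃ z', defect η z' = 1 / 256 :=
    mem_range_of_exists_le_of_exists_ge (continuous_defect η) ⟨z, hηz.trans hz.le⟩
      ((exists_defect_gt hηc (1 / 256)).imp fun _ h => h.le)
  obtain ⟨s, hs, hsR⟩ := hR z' fun h hh hhc => by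
    by_contra! hlt
    have h1 := hdist h z' hlt.le
    have h2 := hG.commute_of_defect_le hh hη h1.le hz'.le
    exact (hηmin h hh hhc (commute_trans h2 hcomm hηc) z').not_gt (hz' ▸ h1)
  by_contra hne
  obtain ⟨k, hk⟩ := exists_proportional_of_commute hcomm.symm hηc
  have h4 : 4 < trSq η := by
    refine (hG.four_le_trSq η hη hηc).lt_of_ne fun h => hne ?_
    have := hk.trSq
    rw [← h] at this
    linarith
  have h5 := hmin (s * η * s⁻¹) ⟨⟨G.mul_mem (G.mul_mem hs hη) (G.inv_mem hs), s • z', hsR, by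
    have := dist_le_defect_add_two (s * η * s⁻¹) (s • z')
    rwa [defect_conj, hz'] at this⟩, by
    change 4 < trSq _
    rwa [trSq_conj]⟩
  simp only [trSq_conj] at h5
  have := trSq_sub_le_defect η z
  linarith

end IsDiscreteNonelliptic

/-! ### Walking in ℍ with a linear number of steps -/

section Chains

variable {ε : ℝ} {P : ℕ → ℍ → Prop}

theorem reach_vertical (hstep : ∀ n z w, P n z → dist z w ≤ ε → P (n + 1) w)
    {n : ℕ} {z : ℍ} (hz : P n z) (k : ℕ) :
    ∀ w : ℍ, z.re = w.re → |Real.log z.im - Real.log w.im| ≤ k * ε → P (n + k) w := by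
  induction k with
  | zero =>
    intro w hre h
    have h0 : Real.log z.im = Real.log w.im := by
      simpa [sub_eq_zero] using h
    have him := Real.log_injOn_pos z.im_pos w.im_pos h0
    rwa [← UpperHalfPlane.ext_re_im hre him]
  | succ k ih =>
    intro w hre h
    set t := Real.log z.im + k / (k + 1) * (Real.log w.im - Real.log z.im) with ht
    have hk : (0 : ℝ) < k + 1 := by positivity
    rw [abs_sub_comm] at h
    push_cast at h
    have hε : |Real.log w.im - Real.log z.im| / (k + 1) ≤ ε := by
      rw [div_le_iff₀ hk]; linarith
    have h1 := ih ⟨⟨z.re, Real.exp t⟩, Real.exp_pos t⟩ rfl (by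
      change |Real.log z.im - Real.log (Real.exp t)| ≤ _
      rw [Real.log_exp, ht, sub_add_cancel_left, abs_neg, abs_mul, abs_of_nonneg (by positivity),
        div_mul_eq_mul_div, mul_div_assoc]
      gcongr)
    refine hstep _ _ _ h1 ?_
    rw [dist_of_re_eq (by exact hre), Real.dist_eq]
    change |Real.log (Real.exp t) - _| ≤ ε
    rw [Real.log_exp, ht]
    have : Real.log z.im + k / (k + 1) * (Real.log w.im - Real.log z.im) - Real.log w.im =
        -((Real.log w.im - Real.log z.im) / (k + 1)) := by
      field_simp
      ring
    rwa [this, abs_neg, abs_div, abs_of_pos hk]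

theorem exists_reach_of_step (hε : 0 < ε) (h0 : P 0 I)
    (hstep : ∀ n z w, P n z → dist z w ≤ ε → P (n + 1) w) :
    ∃ a b : ℝ, 0 ≤ a ∧ 0 ≤ b ∧ ∀ z : ℍ, ∃ n : ℕ, (n : ℝ) ≤ a * dist I z + b ∧ P n z := by
  set C := max 1 (1 / ε ^ 2) with hC
  have hC1 : 1 ≤ C := le_max_left _ _
  have hC2 : 1 / ε ^ 2 ≤ C := le_max_right _ _
  refine ⟨1 / ε, Real.log (2 * C) / ε + 3, by positivity,
    by have := Real.log_nonneg (show 1 ≤ 2 * C by linarith); positivity, fun z => ?_⟩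
  have hy := z.im_pos
  -- Go up from i to height T, across, and down to z. As T ≥ |x|/ε, one step suffices for the
  -- crossing. The vertical length 2 log T − log y is at most d(i, z) plus a constant, because (1 +
  -- x² + y²)/y = 2 cosh d(i, z).
  set T := max 1 (max z.im (|z.re| / ε)) with hT
  have hT1 : 1 ≤ T := le_max_left _ _
  have hTy : z.im ≤ T := (le_max_left _ _).trans (le_max_right _ _)
  have hTx : |z.re| / ε ≤ T := (le_max_right _ _).trans (le_max_right _ _)
  have hT0 : 0 < T := by linarith
  have hlogT : 0 ≤ Real.log T := Real.log_nonneg hT1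
  have hlogy : Real.log z.im ≤ Real.log T := Real.log_le_log hy hTy
  set k₁ := ⌈Real.log T / ε⌉₊ with hk₁
  set k₂ := ⌈(Real.log T - Real.log z.im) / ε⌉₊ with hk₂
  have hk₁' : Real.log T ≤ k₁ * ε := (div_le_iff₀ hε).1 (Nat.le_ceil _)
  have hk₂' : Real.log T - Real.log z.im ≤ k₂ * ε := (div_le_iff₀ hε).1 (Nat.le_ceil _)
  have h1 := reach_vertical hstep h0 k₁ ⟨⟨0, T⟩, hT0⟩ rfl (by
    change |Real.log (I : ℍ).im - Real.log T| ≤ _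
    rwa [I_im, Real.log_one, zero_sub, abs_neg, abs_of_nonneg hlogT])
  have h2 := hstep _ _ ⟨⟨z.re, T⟩, hT0⟩ h1 (by
    refine (dist_le_dist_coe_div_sqrt _ _).trans ?_
    change dist (⟨0, T⟩ : ℂ) ⟨z.re, T⟩ / √(T * T) ≤ ε
    rw [Complex.dist_of_im_eq (by rfl), Real.dist_eq, zero_sub, abs_neg, Real.sqrt_mul_self hT0.le]
    rw [div_le_iff₀ hε] at hTx
    rw [div_le_iff₀ hT0]
    linarith)
  have h3 := reach_vertical hstep h2 k₂ z rfl (by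
    change |Real.log T - _| ≤ _
    rwa [abs_of_nonneg (by linarith)])
  refine ⟨_, ?_, h3⟩
  have hc : (1 + z.re ^ 2 + z.im ^ 2) / z.im = 2 * Real.cosh (dist I z) := by
    rw [cosh_dist, Complex.dist_eq, ← Complex.normSq_eq_norm_sq, Complex.normSq_apply]
    simp
    field_simp
    ring
  have hT2 : T ^ 2 ≤ C * (1 + z.re ^ 2 + z.im ^ 2) := by
    have hx2 := sq_nonneg z.re
    have hy2 := sq_nonneg z.im
    rcases max_cases 1 (max z.im (|z.re| / ε)) with ⟨h, -⟩ | ⟨h, -⟩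
    · rw [hT, h]; nlinarith
    · rcases max_cases z.im (|z.re| / ε) with ⟨h', -⟩ | ⟨h', -⟩
      · rw [hT, h, h']; nlinarith
      · rw [hT, h, h', div_pow, sq_abs, div_eq_mul_one_div, mul_comm]
        refine mul_le_mul hC2 ?_ hx2 (by linarith)
        linarith
  have hle : T ^ 2 / z.im ≤ 2 * C * Real.exp (dist I z) := by
    have h4 : Real.cosh (dist I z) ≤ Real.exp (dist I z) := by
      have h5 : Real.exp (-dist I z) ≤ Real.exp (dist I z) :=
        Real.exp_le_exp.2 (by linarith [dist_nonneg (x := I) (y := z)])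
      rw [Real.cosh_eq]; linarith
    calc T ^ 2 / z.im ≤ C * (1 + z.re ^ 2 + z.im ^ 2) / z.im := by gcongr
      _ = C * (2 * Real.cosh (dist I z)) := by rw [mul_div_assoc, hc]
      _ ≤ C * (2 * Real.exp (dist I z)) := by gcongr
      _ = _ := by ring
  have hlog := Real.log_le_log (by positivity) hle
  rw [Real.log_div (by positivity) hy.ne', Real.log_pow,
    Real.log_mul (by positivity) (Real.exp_pos _).ne', Real.log_exp] at hlog
  push_cast at hlog
  have c₁ := (Nat.ceil_lt_add_one (div_nonneg hlogT hε.le)).le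
  have c₂ := (Nat.ceil_lt_add_one (div_nonneg (sub_nonneg.2 hlogy) hε.le)).le
  push_cast
  rw [zero_add]
  calc (k₁ : ℝ) + 1 + k₂ ≤ (Real.log T / ε + 1) + 1 +
        ((Real.log T - Real.log z.im) / ε + 1) := by gcongr
    _ = (2 * Real.log T - Real.log z.im) / ε + 3 := by ring
    _ ≤ (Real.log (2 * C) + dist I z) / ε + 3 := by gcongr
    _ = 1 / ε * dist I z + (Real.log (2 * C) / ε + 3) := by ring

end Chains

/-! ### Frames and the exponential bound -/

theorem exists_le_of_finite {α : Type*} {S : Set α} (hS : S.Finite) (f : α → ℝ) :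
    ∃ M, ∀ x ∈ S, f x ≤ M := by
  obtain ⟨M, hM⟩ := (hS.image f).bddAbove
  exact ⟨M, fun x hx => hM ⟨x, hx, rfl⟩⟩

/-- The non-central elements of `G` that move some point at distance at most `R` from `I` by at
most `r`. -/
def coreSet (G : Subgroup SL(2, ℝ)) (R r : ℝ) : Set SL(2, ℝ) :=
  {e | e ∈ G ∧ e ∉ Subgroup.center SL(2, ℝ) ∧ ∃ x : ℍ, dist I x ≤ R ∧ dist x (e • x) ≤ r}

/-- `γ` is a frame at `z`: it either carries a point near `I` to `z`, or carries an element
commuting with an element of the core set to an element moving `z` by little. -/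
def IsFrame (G : Subgroup SL(2, ℝ)) (R ε : ℝ) (z : ℍ) (γ : SL(2, ℝ)) : Prop :=
  dist I (γ⁻¹ • z) ≤ R ∨ ∃ η ∈ G, η ∉ Subgroup.center SL(2, ℝ) ∧ dist z (η • z) ≤ ε ∧
    ∃ e ∈ coreSet G R (3 * ε), Commute (γ⁻¹ * η * γ) e

theorem conj_inv_notMem_center {g : SL(2, ℝ)} (s : SL(2, ℝ))
    (hg : g ∉ Subgroup.center SL(2, ℝ)) : s⁻¹ * g * s ∉ Subgroup.center SL(2, ℝ) := by
  simpa using conj_notMem_center s⁻¹ hg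

theorem dist_smul_le_of_dist_le {z w : ℍ} {η : SL(2, ℝ)} {ε : ℝ} (hzw : dist z w ≤ ε)
    (hη : dist w (η • w) ≤ ε) : dist z (η • z) ≤ 3 * ε := by
  calc dist z (η • z) ≤ dist z w + dist w (η • w) + dist (η • w) (η • z) := dist_triangle4 ..
    _ ≤ ε + ε + ε := by rw [dist_smul, dist_comm w z]; gcongr
    _ = 3 * ε := by ring

variable {G : Subgroup SL(2, ℝ)} {R ε : ℝ}

theorem conj_mem_coreSet {z w : ℍ} {γ η : SL(2, ℝ)} (hγ : γ ∈ G)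
    (hη : η ∈ G) (hηc : η ∉ Subgroup.center SL(2, ℝ)) (hz : dist I (γ⁻¹ • z) ≤ R)
    (hzw : dist z w ≤ ε) (hw : dist w (η • w) ≤ ε) :
    γ⁻¹ * η * γ ∈ coreSet G R (3 * ε) := by
  refine ⟨G.mul_mem (G.mul_mem (G.inv_mem hγ) hη) hγ, conj_inv_notMem_center γ hηc,
    γ⁻¹ • z, hz, ?_⟩
  rw [mul_smul, smul_inv_smul, mul_smul, dist_smul]
  exact dist_smul_le_of_dist_le hzw hw

namespace IsDiscreteNonelliptic

/-- After a cusp excursion θ = γ⁻¹γ' conjugates a core element e' into the centraliser of a core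
element e. There are finitely many pairs (e, e'), and two such θ for one pair differ by an element
commuting with a parabolic, where N ≤ 1. -/
theorem exists_transition_bound (hG : IsDiscreteNonelliptic G) {N : SL(2, ℝ) → ℝ}
    (hN : ∀ g, 0 ≤ N g) (hmul : ∀ g ∈ G, ∀ h ∈ G, N (g * h) ≤ N g * N h)
    (hpar : ∀ p ∈ G, p ∉ Subgroup.center SL(2, ℝ) → trSq p = 4 → ∀ g ∈ G, Commute g p → N g ≤ 1)
    (hcore : ∀ e ∈ coreSet G R (3 * ε), trSq e = 4) :
    ∃ M : ℝ, ∀ z w γ γ', γ ∈ G → γ' ∈ G → IsFrame G R ε z γ → dist z w ≤ ε →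
      dist I (γ'⁻¹ • w) ≤ R → N (γ⁻¹ * γ') ≤ M := by
  classical
  have hfin : (coreSet G R (3 * ε)).Finite :=
    (hG.finite_exists_dist_le R (3 * ε)).subset fun e he => ⟨he.1, he.2.2⟩
  let linked : SL(2, ℝ) × SL(2, ℝ) → SL(2, ℝ) → Prop := fun p θ =>
    θ ∈ G ∧ Commute p.1 (θ * p.2 * θ⁻¹)
  -- The chosen θ₀ depends on the pair alone; the default 0 is never used, since `f` is only
  -- evaluated at linked pairs.
  let f : SL(2, ℝ) × SL(2, ℝ) → ℝ := fun p => if h : ∃ θ, linked p θ then N h.choose else 0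
  obtain ⟨M₁, hM₁⟩ := exists_le_of_finite (hG.finite_dist_I_le (R + ε + R)) N
  obtain ⟨M₂, hM₂⟩ := exists_le_of_finite (hfin.prod hfin) f
  refine ⟨max M₁ M₂, fun z w γ γ' hγ hγ' hframe hzw hw => ?_⟩
  have hθ : γ⁻¹ * γ' ∈ G := G.mul_mem (G.inv_mem hγ) hγ'
  rcases hframe with hz | ⟨η, hη, hηc, hzη, e, he, hcomm⟩
  · refine (hM₁ _ ⟨hθ, ?_⟩).trans (le_max_left _ _)
    have h1 : dist I ((γ⁻¹ * γ') • I) = dist (γ • I) (γ' • I) := by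
      rw [← dist_smul γ I, mul_smul, smul_inv_smul]
    have h2 : dist (γ • I) z ≤ R := by
      rwa [← dist_smul γ⁻¹, inv_smul_smul]
    have h3 : dist w (γ' • I) ≤ R := by
      rwa [dist_comm, ← dist_smul γ'⁻¹, inv_smul_smul]
    rw [h1]
    calc _ ≤ dist (γ • I) z + dist z w + dist w (γ' • I) := dist_triangle4 ..
      _ ≤ _ := by gcongr
  · have he' := conj_mem_coreSet hγ' hη hηc hw (by rwa [dist_comm]) hzη
    set e' := γ'⁻¹ * η * γ' with he'_def
    set θ := γ⁻¹ * γ' with hθ_def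
    have hconj : θ * e' * θ⁻¹ = γ⁻¹ * η * γ := by rw [hθ_def, he'_def]; group
    have hlink : ∃ θ, linked (e, e') θ := ⟨θ, hθ, by
      change Commute e (θ * e' * θ⁻¹)
      rw [hconj]; exact hcomm.symm⟩
    have hM := hM₂ (e, e') ⟨he, he'⟩
    simp only [f, dif_pos hlink] at hM
    obtain ⟨hθ₀, hcomm₀⟩ := hlink.choose_spec
    set θ₀ := hlink.choose
    set p := θ₀ * e' * θ₀⁻¹ with hp
    have hpG : p ∈ G := G.mul_mem (G.mul_mem hθ₀ he'.1) (G.inv_mem hθ₀)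
    have hpc : p ∉ Subgroup.center SL(2, ℝ) := conj_notMem_center θ₀ he'.2.1
    have hs : θ * θ₀⁻¹ ∈ G := G.mul_mem hθ (G.inv_mem hθ₀)
    have hcs : Commute (θ * θ₀⁻¹) p := by
      refine hG.commute_of_commute_conj hs hpG hpc ?_
      have h1 : θ * θ₀⁻¹ * p * (θ * θ₀⁻¹)⁻¹ = γ⁻¹ * η * γ := by
        rw [← hconj, hp]; group
      rw [h1]
      exact commute_trans hcomm hcomm₀ he.2.1
    have hNs := hpar p hpG hpc (by rw [hp, trSq_conj]; exact hcore e' he') _ hs hcs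
    calc N θ = N (θ * θ₀⁻¹ * θ₀) := by rw [inv_mul_cancel_right]
      _ ≤ N (θ * θ₀⁻¹) * N θ₀ := hmul _ hs _ hθ₀
      _ ≤ 1 * N θ₀ := by gcongr; exact hN _
      _ ≤ max M₁ M₂ := by rw [one_mul]; exact hM.trans (le_max_right _ _)

/-- A submultiplicative function on `G` that is at most one on the centralisers of the parabolic
elements grows at most exponentially in the displacement. -/
theorem exists_exp_bound (hG : IsDiscreteNonelliptic G) (hthick : HasCocompactThickPart G)
    {N : SL(2, ℝ) → ℝ} (hN : ∀ g, 0 ≤ N g) (hN1 : N 1 ≤ 1)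
    (hmul : ∀ g ∈ G, ∀ h ∈ G, N (g * h) ≤ N g * N h)
    (hpar : ∀ p ∈ G, p ∉ Subgroup.center SL(2, ℝ) → trSq p = 4 →
      ∀ g ∈ G, Commute g p → N g ≤ 1) :
    ∃ A B : ℝ, 0 < A ∧ 0 < B ∧ ∀ g ∈ G, N g ≤ A * Real.exp (B * dist I (g • I)) := by
  obtain ⟨τ, hτ, hpara⟩ := hG.exists_trSq_eq_four_of_defect_lt hthick
  obtain ⟨ε₀, hε₀, hdist⟩ := exists_defect_lt_of_dist_le (c := min τ (1 / 256)) (by positivity)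
  -- An element moving a point by at most ε moves points within ε of it by at most 3ε, which must
  -- still be below the Margulis and parabolicity thresholds.
  obtain ⟨ε, hε, rfl⟩ : ∃ ε > 0, ε₀ = 3 * ε := ⟨ε₀ / 3, by positivity, by ring⟩
  obtain ⟨R₀, hR₀⟩ := hthick ε hε
  set R := max R₀ 0 with hR
  have hcore : ∀ e ∈ coreSet G R (3 * ε), trSq e = 4 := by
    rintro e ⟨he, hec, x, -, hx⟩
    exact hpara e he hec x ((hdist e x hx).trans_le (min_le_left _ _))
  obtain ⟨M₀, hM₀⟩ := hG.exists_transition_bound hN hmul hpar hcore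
  set M := max M₀ 1 with hM
  have hM1 : 1 ≤ M := le_max_right _ _
  let P : ℕ → ℍ → Prop := fun n z => ∃ γ ∈ G, N γ ≤ M ^ n ∧ IsFrame G R ε z γ
  have h0 : P 0 I := ⟨1, G.one_mem, by simpa using hN1, Or.inl (by simp [hR])⟩
  have hmove : ∀ n γ γ', γ ∈ G → γ' ∈ G → N γ ≤ M ^ n → N (γ⁻¹ * γ') ≤ M₀ →
      N γ' ≤ M ^ (n + 1) := by
    intro n γ γ' hγ hγ' h1 h2
    calc N γ' = N (γ * (γ⁻¹ * γ')) := by rw [mul_inv_cancel_left]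
      _ ≤ N γ * N (γ⁻¹ * γ') := hmul _ hγ _ (G.mul_mem (G.inv_mem hγ) hγ')
      _ ≤ M ^ n * M := by
        gcongr
        · exact hN _
        · exact h2.trans (le_max_left _ _)
      _ = M ^ (n + 1) := (pow_succ _ _).symm
  have hstep : ∀ n z w, P n z → dist z w ≤ ε → P (n + 1) w := by
    rintro n z w ⟨γ, hγ, hNγ, hframe⟩ hzw
    by_cases hw : ∀ g ∈ G, g ∉ Subgroup.center SL(2, ℝ) → ε ≤ dist w (g • w)
    · obtain ⟨s, hs, hsR⟩ := hR₀ w hw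
      have hsR' : dist I ((s⁻¹)⁻¹ • w) ≤ R := by
        rw [inv_inv]; exact hsR.trans (le_max_left _ _)
      exact ⟨s⁻¹, G.inv_mem hs, hmove n γ s⁻¹ hγ (G.inv_mem hs) hNγ
        (hM₀ z w γ s⁻¹ hγ (G.inv_mem hs) hframe hzw hsR'), Or.inl hsR'⟩
    · push Not at hw
      obtain ⟨η', hη', hηc', hw⟩ := hw
      refine ⟨γ, hγ, hNγ.trans (pow_le_pow_right₀ hM1 n.le_succ), Or.inr
        ⟨η', hη', hηc', hw.le, ?_⟩⟩
      rcases hframe with hz | ⟨η, hη, hηc, hzη, e, he, hcomm⟩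
      · exact ⟨_, conj_mem_coreSet hγ hη' hηc' hz hzw hw.le, Commute.refl _⟩
      · refine ⟨e, he, ?_⟩
        -- Thin to thin: the old and new short elements are both short at w, hence commute, and γ
        -- remains a frame with the same e.
        have h1 := hdist η w (dist_smul_le_of_dist_le (by rwa [dist_comm]) hzη)
        have h2 := hdist η' w (by linarith)
        have h3 := hG.commute_of_defect_le hη' hη (h2.le.trans (min_le_right _ _))
          (h1.le.trans (min_le_right _ _))
        refine commute_trans ?_ hcomm (conj_inv_notMem_center γ hηc)
        simpa using (Commute.conj_iff γ⁻¹).2 h3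
  obtain ⟨a, b, ha, hb, hreach⟩ := exists_reach_of_step hε h0 hstep
  have hlogM : 0 ≤ Real.log M := Real.log_nonneg hM1
  have hMpos : 0 < M := by linarith
  refine ⟨Real.exp (Real.log M * (b + 1)), Real.log M * a + 1, Real.exp_pos _, by positivity,
    fun g hg => ?_⟩
  obtain ⟨n, hn, γ, hγ, hNγ, hframe⟩ := hreach (g • I)
  -- One last transition, of length zero, from the frame reached at g i to g itself.
  have hg' := hmove n γ g hγ hg hNγ
    (hM₀ (g • I) (g • I) γ g hγ hg hframe (by simpa using hε.le) (by simp [hR]))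
  rw [← Real.exp_add]
  calc N g ≤ M ^ (n + 1) := hg'
    _ = Real.exp (Real.log M * (n + 1)) := by
      rw [← Real.rpow_natCast, Real.rpow_def_of_pos hMpos]; push_cast; rfl
    _ ≤ _ := by
      rw [Real.exp_le_exp]
      have := dist_nonneg (x := I) (y := g • I)
      nlinarith [mul_le_mul_of_nonneg_left hn hlogM]

end IsDiscreteNonelliptic

/-! ### Discreteness and torsion-freeness of the preimage in SL(2, ℝ) -/

/-- The group of matrices in `SL(2, ℝ)` that represent an element of `Γ`. -/
def lift (Γ : Subgroup PSL(2, ℝ)) : Subgroup SL(2, ℝ) :=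
  Γ.comap (QuotientGroup.mk' (Subgroup.center SL(2, ℝ)))

theorem mem_lift {Γ : Subgroup PSL(2, ℝ)} {g : SL(2, ℝ)} : g ∈ lift Γ ↔ (g : PSL(2, ℝ)) ∈ Γ :=
  Iff.rfl

theorem finite_center : (Subgroup.center SL(2, ℝ) : Set SL(2, ℝ)).Finite :=
  (Set.toFinite {1, -1}).subset fun _ hg => eq_one_or_eq_neg_one hg

theorem finite_fiber (q : PSL(2, ℝ)) : {g : SL(2, ℝ) | (g : PSL(2, ℝ)) = q}.Finite := by
  obtain ⟨h, rfl⟩ := QuotientGroup.mk_surjective q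
  refine (finite_center.image (h * ·)).subset fun g hg => ⟨h⁻¹ * g, ?_, mul_inv_cancel_left h g⟩
  exact QuotientGroup.eq.1 (Eq.symm hg)

/-- The orbit map g ↦ g i is proper, and a compact set meets the closed discrete group Γ in a finite
set; the fibres of SL(2, ℝ) → PSL(2, ℝ) are finite. -/
theorem finite_lift_dist_I_le (Γ : Subgroup PSL(2, ℝ)) [DiscreteTopology Γ] (M : ℝ) :
    {g : SL(2, ℝ) | g ∈ lift Γ ∧ dist I (g • I) ≤ M}.Finite := by
  have hcl : IsClosed (Subgroup.center SL(2, ℝ) : Set SL(2, ℝ)) := finite_center.isClosed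
  have hΓ : IsClosed (Γ : Set PSL(2, ℝ)) := Subgroup.isClosed_of_discrete
  have hK : IsCompact {g : SL(2, ℝ) | dist I (g • I) ≤ M} := by
    have := isProperMap_smul_I.isCompact_preimage (isCompact_closedBall I M)
    simpa only [Set.preimage, Metric.mem_closedBall, dist_comm] using this
  have hK' : IsCompact ((QuotientGroup.mk : SL(2, ℝ) → PSL(2, ℝ)) ''
      {g : SL(2, ℝ) | dist I (g • I) ≤ M} ∩ Γ) :=
    (hK.image QuotientGroup.continuous_mk).inter_right hΓ
  have hfin := hK'.finite ((SetLike.isDiscrete_iff_discreteTopology.2 ‹_›).mono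
    Set.inter_subset_right)
  refine (hfin.preimage' fun q _ => finite_fiber q).subset ?_
  rintro g ⟨hg, hM⟩
  exact ⟨⟨g, hM, rfl⟩, hg⟩

/-- An elliptic element fixes some z, so its powers displace i by at most 2d(i, z); by discreteness
it has finite order. -/
theorem four_le_trSq_of_torsionFree (Γ : Subgroup PSL(2, ℝ)) [DiscreteTopology Γ]
    (htf : IsTorsionFreeSubgroup Γ) {g : SL(2, ℝ)} (hg : g ∈ lift Γ)
    (hgc : g ∉ Subgroup.center SL(2, ℝ)) : 4 ≤ trSq g := by
  by_contra! hlt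
  refine htf g hg (fun h => hgc ((QuotientGroup.eq_one_iff g).1 h)) ?_
  refine MonoidHom.isOfFinOrder (QuotientGroup.mk' (Subgroup.center SL(2, ℝ))) (x := g) ?_
  have hell : (Matrix.SpecialLinearGroup.toGL g).IsElliptic := by
    have h := trSq_eq g
    rw [Matrix.GeneralLinearGroup.IsElliptic, Matrix.IsElliptic, Matrix.discr_fin_two,
      Matrix.trace_fin_two, Matrix.det_fin_two]
    have hd := det_eq_one g
    rw [trSq] at hlt
    change (g 0 0 + g 1 1) ^ 2 - 4 * (g 0 0 * g 1 1 - g 0 1 * g 1 0) < 0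
    rw [hd]
    linarith
  obtain ⟨z, hz⟩ : ∃ z : ℍ, g • z = z :=
    ⟨_, (gl_smul_eq_self_iff_eq_fixedPt
      (g := (Matrix.SpecialLinearGroup.toGL g : GL (Fin 2) ℝ)) (by simp) hell).2 rfl⟩
  by_contra hfin
  refine Set.infinite_of_injective_forall_mem (injective_pow_iff_not_isOfFinOrder.2 hfin) ?_
    (finite_lift_dist_I_le Γ (dist I z + dist z I))
  intro n
  refine ⟨Subgroup.pow_mem _ hg n, (dist_triangle I z _).trans ?_⟩
  have hn : g ^ n • z = z := by
    induction n with
    | zero => rw [pow_zero, one_smul]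
    | succ n ih => rw [pow_succ, mul_smul, hz, ih]
  gcongr
  conv_lhs => rw [← hn]
  rw [dist_smul]

theorem isDiscreteNonelliptic_lift (Γ : Subgroup PSL(2, ℝ)) [DiscreteTopology Γ]
    (htf : IsTorsionFreeSubgroup Γ) : IsDiscreteNonelliptic (lift Γ) where
  finite_dist_I_le := finite_lift_dist_I_le Γ
  neg_one_mem := by
    rw [mem_lift, (QuotientGroup.eq_one_iff (-1 : SL(2, ℝ))).2
      ((mem_center_iff_entries _).2 (by simp))]
    exact Γ.one_mem
  four_le_trSq _ := four_le_trSq_of_torsionFree Γ htf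

theorem countable_of_discrete (Γ : Subgroup PSL(2, ℝ)) [DiscreteTopology Γ] : Countable Γ := by
  have h : (lift Γ : Set SL(2, ℝ)).Countable := by
    refine (Set.countable_iUnion fun n : ℕ => (finite_lift_dist_I_le Γ n).countable).mono ?_
    intro g hg
    obtain ⟨n, hn⟩ := exists_nat_ge (dist I (g • I))
    exact Set.mem_iUnion.2 ⟨n, hg, hn⟩
  refine ((h.image (QuotientGroup.mk : SL(2, ℝ) → PSL(2, ℝ))).mono ?_ :
    (Γ : Set PSL(2, ℝ)).Countable).to_subtype
  intro q hq
  obtain ⟨g, rfl⟩ := QuotientGroup.mk_surjective q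
  exact ⟨g, hq, rfl⟩

/-! ### Finite covolume makes the thick part cocompact -/

instance : SMulInvariantMeasure SL(2, ℝ) ℍ volume where
  measure_preimage_smul g _ hs :=
    SMulInvariantMeasure.measure_preimage_smul (M := GL (Fin 2) ℝ) (μ := (volume : Measure ℍ))
      (Matrix.SpecialLinearGroup.toGL g) hs

instance (Γ : Subgroup PSL(2, ℝ)) : SMulInvariantMeasure Γ ℍ volume where
  measure_preimage_smul := by
    rintro ⟨q, hq⟩ s hs
    obtain ⟨g, rfl⟩ := QuotientGroup.mk_surjective q
    exact SMulInvariantMeasure.measure_preimage_smul (M := SL(2, ℝ)) (μ := (volume : Measure ℍ))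
      g hs

instance (Γ : Subgroup PSL(2, ℝ)) : MeasurableConstSMul Γ ℍ where
  measurable_const_smul := by
    rintro ⟨q, hq⟩
    obtain ⟨g, rfl⟩ := QuotientGroup.mk_surjective q
    exact (continuous_const_smul g : Continuous fun z : ℍ => g • z).measurable

theorem volume_ball_eq (z : ℍ) (r : ℝ) :
    (volume : Measure ℍ) (Metric.ball z r) = volume (Metric.ball I r) := by
  conv_lhs => rw [← toSL2R_smul_I z, ← Metric.smul_ball, measure_smul]

theorem volume_ball_I_pos {r : ℝ} (hr : 0 < r) : 0 < (volume : Measure ℍ) (Metric.ball I r) := by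
  rw [volume_eq_lintegral, setLIntegral_pos_iff (by fun_prop)]
  have : Function.support (fun z : ℂ => (((1 / ‖z.im‖₊) ^ 2 : NNReal) : ENNReal)) ∩
      UpperHalfPlane.coe '' Metric.ball I r = UpperHalfPlane.coe '' Metric.ball I r := by
    refine Set.inter_eq_right.2 ?_
    rintro _ ⟨z, -, rfl⟩
    simpa using z.im_ne_zero
  rw [this]
  exact (isOpenEmbedding_coe.isOpenMap _ Metric.isOpen_ball).measure_pos _
    ((Metric.nonempty_ball.2 hr).image _)

theorem exists_separated_of_unbounded {G : Subgroup SL(2, ℝ)} {ε : ℝ} {T : Set ℍ} (hε : 0 < ε)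
    (hT : ∀ R, ∃ z ∈ T, ∀ g ∈ G, R < dist I (g • z)) (n : ℕ) :
    ∃ s : Finset ℍ, s.card = n ∧ (∀ z ∈ s, z ∈ T) ∧
      ∀ z ∈ s, ∀ w ∈ s, z ≠ w → ∀ g ∈ G, ε ≤ dist z (g • w) := by
  classical
  induction n with
  | zero => exact ⟨∅, by simp⟩
  | succ n ih =>
    obtain ⟨s, hcard, hsT, hsep⟩ := ih
    obtain ⟨R, hR⟩ := exists_le_of_finite s.finite_toSet (dist I)
    obtain ⟨z, hzT, hz⟩ := hT (R + ε)
    have hfar : ∀ w ∈ s, ∀ g ∈ G, ε ≤ dist w (g • z) := by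
      intro w hw g hg
      have := dist_triangle I w (g • z)
      have := hR w hw
      have := hz g hg
      linarith
    have hzs : z ∉ s := fun h => by
      have := hfar z h 1 G.one_mem
      rw [one_smul, dist_self] at this
      linarith
    refine ⟨insert z s, by rw [Finset.card_insert_of_notMem hzs, hcard], ?_, ?_⟩
    · intro w hw
      rcases Finset.mem_insert.1 hw with rfl | hw
      exacts [hzT, hsT w hw]
    · intro w hw w' hw' hne g hg
      rcases Finset.mem_insert.1 hw with rfl | hws <;>
        rcases Finset.mem_insert.1 hw' with rfl | hws'
      · exact absurd rfl hne
      · rw [← dist_smul g⁻¹, inv_smul_smul, dist_comm]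
        exact hfar w' hws' _ (G.inv_mem hg)
      · exact hfar w hws g hg
      · exact hsep w hws w' hws' hne g hg

theorem hasCocompactThickPart_lift (Γ : Subgroup PSL(2, ℝ)) [DiscreteTopology Γ] {F : Set ℍ}
    (hF : IsFundamentalDomain Γ F (volume : Measure ℍ)) (hvol : (volume : Measure ℍ) F < ⊤) :
    HasCocompactThickPart (lift Γ) := by
  have := countable_of_discrete Γ
  intro ε hε
  by_contra! hR
  have hr : 0 < ε / 2 := by positivity
  obtain ⟨n, hn⟩ := ENNReal.exists_nat_mul_gt (volume_ball_I_pos hr).ne' hvol.ne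
  obtain ⟨s, hcard, hthick, hsep⟩ := exists_separated_of_unbounded (G := lift Γ) (T := {z |
    ∀ g ∈ lift Γ, g ∉ Subgroup.center SL(2, ℝ) → ε ≤ dist z (g • z)}) hε hR n
  have hsum : (volume : Measure ℍ) (⋃ z ∈ s, Metric.ball z (ε / 2)) =
      n * volume (Metric.ball I (ε / 2)) := by
    rw [measure_biUnion_finset]
    · simp only [volume_ball_eq _ (ε / 2), Finset.sum_const, hcard, nsmul_eq_mul]
    · intro z hz w hw hne
      refine Metric.ball_disjoint_ball ?_
      have := hsep z hz w hw hne 1 (Subgroup.one_mem _)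
      rw [one_smul] at this
      linarith
    · exact fun z _ => Metric.isOpen_ball.measurableSet
  -- The disjoint ε/2-balls have total volume above that of F, so a nontrivial element of Γ
  -- identifies two of their points. Within one ball this contradicts thickness, between two balls
  -- separation of orbits.
  obtain ⟨x, hx, y, hy, ⟨q, hq⟩, hne, rfl⟩ := hF.exists_ne_one_smul_eq
    (Finset.measurableSet_biUnion s fun z _ =>
      Metric.isOpen_ball.measurableSet).nullMeasurableSet (hn.trans_eq hsum.symm)
  obtain ⟨g, rfl⟩ := QuotientGroup.mk_surjective q
  simp only [Set.mem_iUnion, Metric.mem_ball, exists_prop] at hx hy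
  obtain ⟨z, hz, hxz⟩ := hx
  obtain ⟨w, hw, hyw⟩ := hy
  replace hyw : dist (g • x) w < ε / 2 := hyw
  have hlt : dist w (g • z) < ε := by
    have h1 := dist_triangle w (g • x) (g • z)
    rw [dist_smul, dist_comm w (g • x)] at h1
    linarith
  rcases eq_or_ne w z with rfl | hwz
  · refine hlt.not_ge (hthick w hw g hq fun hc => hne ?_)
    exact Subtype.ext ((QuotientGroup.eq_one_iff g).2 hc)
  · exact hlt.not_ge (hsep w hw z hz hwz g hq)

/-! ### Unitary operators and stabilisers of cusps -/

section OpNorm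

variable {V : Type*} [NormedAddCommGroup V] [InnerProductSpace ℂ V] [FiniteDimensional ℂ V]

theorem opNorm_nonneg (T : V →ₗ[ℂ] V) : 0 ≤ opNorm T := norm_nonneg _

theorem opNorm_mul_le (S T : V →ₗ[ℂ] V) : opNorm (S * T) ≤ opNorm S * opNorm T :=
  ContinuousLinearMap.opNorm_comp_le (LinearMap.toContinuousLinearMap S)
    (LinearMap.toContinuousLinearMap T)

theorem opNorm_le_one_of_mem_unitary {T : V →ₗ[ℂ] V} (hT : T ∈ unitary (V →ₗ[ℂ] V)) :
    opNorm T ≤ 1 := by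
  refine ContinuousLinearMap.opNorm_le_bound _ zero_le_one fun x => ?_
  have h : inner ℂ (T x) (T x) = inner ℂ x x := by
    rw [← LinearMap.adjoint_inner_right]
    have := congrArg (fun f : V →ₗ[ℂ] V => f x) (Unitary.mem_iff.1 hT).1
    simp only [Module.End.mul_apply, Module.End.one_apply] at this
    rw [LinearMap.star_eq_adjoint] at this
    rw [this]
  have h2 : ‖T x‖ ^ 2 = ‖x‖ ^ 2 := by
    rw [@norm_sq_eq_re_inner ℂ, h, ← @norm_sq_eq_re_inner ℂ]
  rw [one_mul]
  exact ((sq_eq_sq₀ (norm_nonneg _) (norm_nonneg _)).1 h2).le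

end OpNorm

theorem isParabolic_of_trSq_eq_four {p : SL(2, ℝ)} (hp : p ∉ Subgroup.center SL(2, ℝ))
    (h4 : trSq p = 4) : (p : Matrix (Fin 2) (Fin 2) ℝ).IsParabolic := by
  constructor
  · rintro ⟨r, hr⟩
    have h : ∀ i j, p i j = Matrix.scalar (Fin 2) r i j := fun i j => by rw [hr]
    exact hp ((mem_center_iff_entries p).2 (by simp [h]))
  · rw [Matrix.discr_fin_two, Matrix.trace_fin_two, p.det_coe]
    rw [trSq] at h4
    linarith

/-- An element of `Γ` commuting with a parabolic element of `Γ` fixes a cusp. -/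
theorem exists_cusp_fixed {Γ : Subgroup PSL(2, ℝ)} {p g : SL(2, ℝ)} (hp : p ∈ lift Γ)
    (hpc : p ∉ Subgroup.center SL(2, ℝ)) (h4 : trSq p = 4) (hcomm : Commute g p) :
    ∃ c : OnePoint ℝ, IsCuspOf Γ c ∧ (g : PSL(2, ℝ)) • c = c := by
  classical
  have hpar := isParabolic_of_trSq_eq_four hpc h4
  have hpar' : (Matrix.SpecialLinearGroup.toGL p).IsParabolic := hpar
  set c := (Matrix.SpecialLinearGroup.toGL p).parabolicFixedPoint with hc
  have hfix : Matrix.SpecialLinearGroup.toGL p • c = c := hpar'.smul_eq_self_iff.2 rfl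
  refine ⟨c, (isCuspOf_iff Γ c).2 ⟨p, hp, hpar, hfix⟩, ?_⟩
  rw [psl_mk_smul_boundary]
  -- Commuting with p, g permutes the fixed points of p, of which there is only one.
  refine hpar'.smul_eq_self_iff.1 ?_
  rw [← mul_smul, ← map_mul, ← hcomm.eq, map_mul, mul_smul, hfix]

end FuchsianTwist

end

/-! ### The two bounds -/

open FuchsianTwist

theorem proposition2p9 (Γ : Subgroup PSL(2, ℝ))
    (hlattice : FuchsianTwist.IsLattice Γ)
    (htorsion : FuchsianTwist.IsTorsionFreeSubgroup Γ)
    (hcusp : ∃ c : OnePoint ℝ, FuchsianTwist.IsCuspOf Γ c)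
    {V : Type*} [NormedAddCommGroup V] [InnerProductSpace ℂ V] [FiniteDimensional ℂ V]
    (χ : Representation ℂ Γ V) (hχ : FuchsianTwist.UnitaryAtCusps χ) :
    ∃ σ₀ : ℝ, 1 < σ₀ ∧
      (∃ C : ℝ, 0 < C ∧ ∀ γ : Γ,
        FuchsianTwist.opNorm (χ γ) ≤ C * FuchsianTwist.mu (γ : PSL(2, ℝ)) ^ (σ₀ - 1)) ∧
      (∃ C : ℍ × ℍ → ℝ, Continuous C ∧ (∀ p, 0 < C p) ∧ ∀ (z w : ℍ) (γ : Γ),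
        FuchsianTwist.opNorm (χ γ) ≤ C (z, w) * (FuchsianTwist.u z (γ • w) + 1) ^ (σ₀ - 1)) := by
  classical
  have := hlattice.discrete
  obtain ⟨F, hF, hvol⟩ := hlattice.finite_covolume
  let N : SL(2, ℝ) → ℝ := fun g =>
    if h : (g : PSL(2, ℝ)) ∈ Γ then opNorm (χ ⟨g, h⟩) else 0
  have hN : ∀ (g : SL(2, ℝ)) (h : (g : PSL(2, ℝ)) ∈ Γ), N g = opNorm (χ ⟨g, h⟩) := fun g h => dif_pos h
  have hone : opNorm (1 : V →ₗ[ℂ] V) ≤ 1 := opNorm_le_one_of_mem_unitary (one_mem _)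
  obtain ⟨A, B, hA, hB, hbound⟩ := (isDiscreteNonelliptic_lift Γ htorsion).exists_exp_bound
    (hasCocompactThickPart_lift Γ hF hvol) (N := N)
    (fun g => by
      by_cases h : (g : PSL(2, ℝ)) ∈ Γ
      · rw [hN g h]; exact opNorm_nonneg _
      · simp [N, h])
    (by
      rw [hN 1 Γ.one_mem]
      change opNorm (χ 1) ≤ 1
      rwa [map_one])
    (fun g hg h hh => by
      rw [hN g hg, hN h hh, hN (g * h) (Γ.mul_mem hg hh)]
      refine le_of_eq_of_le ?_ (opNorm_mul_le _ _)
      rw [← map_mul]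
      rfl)
    (fun p hp hpc h4 g hg hcomm => by
      obtain ⟨c, hc, hfix⟩ := exists_cusp_fixed hp hpc h4 hcomm
      rw [hN g hg]
      exact opNorm_le_one_of_mem_unitary (hχ c hc ⟨g, hg⟩ hfix))
  have hcosh : ∀ d : ℝ, Real.exp d ≤ 2 * Real.cosh d := fun d => by
    rw [Real.cosh_eq]
    linarith [Real.exp_pos (-d)]
  have hexp : ∀ d : ℝ, Real.exp (B * d) ≤ (2 * Real.cosh d) ^ B := fun d => by
    rw [mul_comm, Real.exp_mul]
    exact Real.rpow_le_rpow (Real.exp_pos d).le (hcosh d) hB.le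
  -- σ₀ − 1 is the exponential rate B. In C₂ the exponential pays for moving the base points from i
  -- to z and w, and 2^B for 2 cosh d = u + 2 ≤ 2(u + 1).
  refine ⟨1 + B, by linarith, ⟨A, hA, ?_⟩,
    fun p => A * 2 ^ B * Real.exp (B * (dist I p.1 + dist p.2 I)), by fun_prop,
    fun p => by positivity, ?_⟩
  · rintro ⟨q, hq⟩
    obtain ⟨g, rfl⟩ := QuotientGroup.mk_surjective q
    rw [add_sub_cancel_left, ← hN g hq, mu_mk, mu_eq_two_cosh]
    exact (hbound g hq).trans (mul_le_mul_of_nonneg_left (hexp _) hA.le)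
  · rintro z w ⟨q, hq⟩
    obtain ⟨g, rfl⟩ := QuotientGroup.mk_surjective q
    rw [add_sub_cancel_left, ← hN g hq]
    change N g ≤ _ * (u z (g • w) + 1) ^ B
    have hu : 2 * Real.cosh (dist z (g • w)) ≤ 2 * (u z (g • w) + 1) := by
      rw [cosh_dist, u, Complex.dist_eq]
      have := z.im_pos
      have := (g • w).im_pos
      have h : 0 ≤ ‖(z : ℂ) - (g • w : ℍ)‖ ^ 2 / (z.im * (g • w).im) := by positivity
      rw [mul_assoc, mul_comm 2 (z.im * _), ← div_div]
      linarith
    have hd : dist I (g • I) ≤ (dist I z + dist w I) + dist z (g • w) := by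
      have := dist_triangle4 I z (g • w) (g • I)
      rw [dist_smul] at this
      linarith
    calc N g ≤ A * Real.exp (B * dist I (g • I)) := hbound g hq
      _ ≤ A * Real.exp (B * ((dist I z + dist w I) + dist z (g • w))) := by gcongr
      _ = A * (Real.exp (B * (dist I z + dist w I)) * Real.exp (B * dist z (g • w))) := by
        rw [mul_add, Real.exp_add]
      _ ≤ A * (Real.exp (B * (dist I z + dist w I)) * (2 * (u z (g • w) + 1)) ^ B) := by
        gcongr
        exact (hexp _).trans (Real.rpow_le_rpow (by positivity) hu hB.le)
      _ = A * 2 ^ B * Real.exp (B * (dist I z + dist w I)) * (u z (g • w) + 1) ^ B := by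
        have h0 : 0 ≤ u z (g • w) + 1 := by
          have := Real.cosh_pos (dist z (g • w))
          linarith
        rw [Real.mul_rpow zero_le_two h0]
        ring
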